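/- For a covariant functor $F$ from topological spaces to abelian groups, two spaces $X$ and $Y$ are called hereditarily $F$-equivalent if there are a bijection $f : X \to Y$ (not assumed continuous) and, for every subspace $M \subseteq X$, an isomorphism $f_*(M) : F(M) \to F(f(M))$ such that for all $N \subseteq M \subseteq X$ the square formed by $f_*(N)$, $f_*(M)$ and the homomorphisms $F(N) \to F(M)$ and $F(f(N)) \to F(f(M))$ induced by the inclusions commutes. Let $H_n^s$ denote $n$-dimensional singular homology with integer coefficients. **Theorem.** Let $n \ge 1$ and let $X$ be a metrisable $H_n^s$-bubble, that is, a metrisable space that is hereditarily $H_n^s$-equivalent to the $n$-dimensional sphere $S^n$. Then $X$ is a Peano continuum, i.e. a compact, connected, locally connected metrisable space. Moreover, whenever a singular cycle $\sum_{i} a_i \sigma_i$ (a finite sum, $a_i \in \mathbf{Z}$, $\sigma_i : \Delta^n \to X$ continuous) represents a generator of $H_n^s(X)$, the space $X$ is the union of the images $\sigma_i(\Delta^n)$. -/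

import Mathlib

open CategoryTheory AlgebraicTopology Opposite
open scoped Simplicial

universe u w

namespace Bubble

noncomputable section

/-- The inclusion `N ⟶ M` of subspaces of `X`, for subsets `N ⊆ M ⊆ X`. -/
def inclusion {X : TopCat.{u}} {N M : Set X} (h : N ⊆ M) : TopCat.of N ⟶ TopCat.of M :=
  TopCat.ofHom ⟨Set.inclusion h, continuous_inclusion h⟩

/-- A hereditary `F`-equivalence of the spaces `X` and `Y`, for a covariant functor `F` from
topological spaces to abelian groups: a bijection `f : X → Y` (not required to be continuous),
with an isomorphism `F(M) ≅ F(f(M))` for every subspace `M` of `X`, compatible with the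
homomorphisms that are induced by the inclusions `N ⊆ M`. -/
structure HereditaryEquiv (F : TopCat.{u} ⥤ AddCommGrpCat.{w}) (X Y : TopCat.{u}) where
  /-- the underlying bijection -/
  toEquiv : X ≃ Y
  /-- the isomorphism `F(M) ≅ F(f(M))` -/
  iso (M : Set X) : F.obj (TopCat.of M) ≅ F.obj (TopCat.of (toEquiv '' M))
  /-- the squares given by inclusions commute -/
  comm {N M : Set X} (h : N ⊆ M) :
    (iso N).hom ≫ F.map (inclusion (Set.image_mono h)) = F.map (inclusion h) ≫ (iso M).hom

/-- An `n`-dimensional `F`-bubble: a space that is hereditarily `F`-equivalent to the `n`-sphere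
(the unit sphere of the Euclidean space of dimension `n + 1`). -/
def IsBubble (F : TopCat.{u} ⥤ AddCommGrpCat.{w}) (n : ℕ) (X : TopCat.{u}) : Prop :=
  Nonempty (HereditaryEquiv F X (TopCat.sphere.{u} n))

/-- The group of integers, as an abelian group in the universe `u`. -/
abbrev integers : AddCommGrpCat.{u} := AddCommGrpCat.of (ULift.{u} ℤ)

/-- The functor `H_n^s` of `n`-dimensional singular homology with integer coefficients. -/
def singularHomology (n : ℕ) : TopCat.{u} ⥤ AddCommGrpCat.{u} :=
  (singularHomologyFunctor AddCommGrpCat.{u} n).obj integers.{u}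

/-- The singular chain complex of `X` with integer coefficients, whose `n`-th homology is the value
of `singularHomology n` at `X`. -/
abbrev singularChains (X : TopCat.{u}) : ChainComplex AddCommGrpCat.{u} ℕ :=
  ((singularChainComplexFunctor AddCommGrpCat.{u}).obj integers.{u}).obj X

/-- The singular `n`-chain `a • σ`, for an integer `a` and a singular `n`-simplex `σ` of `X`. -/
def simplexChain {X : TopCat.{u}} {n : ℕ} (a : ℤ) (σ : C(stdSimplex ℝ (Fin (n + 1)), X)) :
    (singularChains X).X n :=
  SSet.ιChainComplex (R := integers.{u}) (TopCat.toSSet.obj X)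
    ((TopCat.toSSetObjEquiv X (op ⦋n⦌)).symm σ) (ULift.up a)

/-- The homology class `c ∈ H_n^s(X)` is represented by the singular cycle
`a 0 • σ 0 + ... + a (m - 1) • σ (m - 1)`. -/
def IsRepresentedBy {X : TopCat.{u}} {n m : ℕ} (c : (singularHomology n).obj X)
    (a : Fin m → ℤ) (σ : Fin m → C(stdSimplex ℝ (Fin (n + 1)), X)) : Prop :=
  ∃ z : (singularChains X).cycles n,
    (singularChains X).iCycles n z = ∑ i, simplexChain (a i) (σ i) ∧
      (singularChains X).homologyπ n z = c

/-- A Peano continuum: a compact, connected (in particular nonempty), locally connected,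
metrisable space. -/
structure IsPeanoContinuum (X : Type u) [TopologicalSpace X] : Prop where
  metrizable : TopologicalSpace.MetrizableSpace X
  compact : CompactSpace X
  connected : ConnectedSpace X
  locallyConnected : LocallyConnectedSpace X

end

end Bubble

/-!
The only facts about the sphere that matter are that its `n`-th homology is nonzero
(`Bubble.exists_ne_zero_sphere`) and that every proper subspace `M` carries none of it: the map
`H_n(M) → H_n(S^n)` is zero because the inclusion is homotopic to a constant map
(`Bubble.map_subspaceMap_sphere_eq_zero`). The group `H_n(M)` itself need not vanish. Both facts are
transported to `X` by the hereditary equivalence.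

A class represented by `∑ aᵢ σᵢ` comes from the subspace `⋃ σᵢ(Δⁿ)`. If the class is nonzero, this
subspace therefore is all of `X` (`Bubble.iUnion_range_eq_univ`). As some class is nonzero, `X` is a
finite union of images of simplices, hence compact, and, being Hausdorff, a quotient of a finite
disjoint union of simplices, hence locally connected. A generator is nonzero, which gives the
statement about cycles. If `X` were the disjoint union of clopen nonempty `A` and `B`, then the
identity of `H_n(X)` would be a combination of maps induced by maps of `X` into `A`, into `B` and
into a two-point set, all of which vanish (`Bubble.preconnectedSpace_of_map_subspaceMap_eq_zero`).

The nonvanishing of `H_n(S^n)` is deduced from a Sperner type argument. The sphere retracts onto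
a copy of the boundary of the `(n + 1)`-simplex, so it suffices that the boundary of the identity
simplex `ι` of `Δⁿ⁺¹` does not bound a chain `y` of the boundary of `Δⁿ⁺¹`
(`Bubble.d_subspaceMap_ne`). Replace every singular simplex by the chain of vertex tuples of its
`k`-fold barycentric subdivision, and move every vertex to the corner of `Δⁿ⁺¹` at which its
barycentric coordinate is largest. This is a chain map to tuples in the hyperplane of coordinate sum
`1`, where the determinant is a cocycle that vanishes on cycles of top length. So it vanishes on the
image of `y - ι`. On the image of `ι` it is `1` (`Bubble.detCochain_map_labelVertex`). For large `k`
it is `0` on the image of `y`, because near a point with vanishing `i`-th coordinate no vertex is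
moved to the `i`-th corner (`Bubble.exists_detCochain_sampleSimplex_eq_zero`).
-/

namespace Bubble

noncomputable section

/-! ### Chains of ordered tuples -/

/-- The group of integral chains on the `n`-tuples of points of `E`. The indexing is by the number
of points, so that a tuple of length `n + 1` plays the role of an `n`-simplex and the complex is
augmented by the empty tuple in length `0`. -/
abbrev TupleChain (E : Type*) (n : ℕ) : Type _ := (Fin n → E) →₀ ℤ

namespace TupleChain

variable {E E' E'' : Type*} {n : ℕ}

lemma hom_ext {M : Type*} [AddCommGroup M] {f g : TupleChain E n →ₗ[ℤ] M}
    (h : ∀ v, f (Finsupp.single v 1) = g (Finsupp.single v 1)) : f = g :=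
  Finsupp.lhom_ext' fun v => LinearMap.ext_ring (h v)

/-- The alternating sum of the faces. -/
def boundary (E : Type*) (n : ℕ) : TupleChain E (n + 1) →ₗ[ℤ] TupleChain E n :=
  Finsupp.linearCombination ℤ fun v =>
    ∑ i : Fin (n + 1), (-1 : ℤ) ^ (i : ℕ) • Finsupp.single (fun j => v (i.succAbove j)) 1

lemma boundary_single (v : Fin (n + 1) → E) :
    boundary E n (Finsupp.single v 1) =
      ∑ i : Fin (n + 1), (-1 : ℤ) ^ (i : ℕ) • Finsupp.single (fun j => v (i.succAbove j)) 1 := by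
  simp [boundary]

/-- The map induced on chains by a map of sets. -/
def map (g : E → E') (n : ℕ) : TupleChain E n →ₗ[ℤ] TupleChain E' n :=
  Finsupp.lmapDomain ℤ ℤ (g ∘ ·)

@[simp] lemma map_single (g : E → E') (v : Fin n → E) (a : ℤ) :
    map g n (Finsupp.single v a) = Finsupp.single (g ∘ v) a := by
  simp [map]

lemma map_map (g : E → E') (g' : E' → E'') (c : TupleChain E n) :
    map g' n (map g n c) = map (g' ∘ g) n c := by
  have : map g' n ∘ₗ map g n = map (g' ∘ g) n := hom_ext fun v => by
    simp [Function.comp_assoc]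
  exact LinearMap.congr_fun this c

lemma boundary_map (g : E → E') (c : TupleChain E (n + 1)) :
    boundary E' n (map g (n + 1) c) = map g n (boundary E n c) := by
  have : boundary E' n ∘ₗ map g (n + 1) = map g n ∘ₗ boundary E n := hom_ext fun v => by
    simp only [LinearMap.comp_apply, map_single, boundary_single, map_sum, map_smul]
    rfl
  exact LinearMap.congr_fun this c

/-- The cone with apex `b`, which puts `b` in front of every tuple. -/
def cone (b : E) (n : ℕ) : TupleChain E n →ₗ[ℤ] TupleChain E (n + 1) :=
  Finsupp.lmapDomain ℤ ℤ fun v => Fin.cons b v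

@[simp] lemma cone_single (b : E) (v : Fin n → E) (a : ℤ) :
    cone b n (Finsupp.single v a) = Finsupp.single (Fin.cons b v) a := by
  simp [cone]

lemma map_cone (g : E → E') (b : E) (c : TupleChain E n) :
    map g (n + 1) (cone b n c) = cone (g b) n (map g n c) := by
  have : map g (n + 1) ∘ₗ cone b n = cone (g b) n ∘ₗ map g n := hom_ext fun v => by
    simp only [LinearMap.comp_apply, map_single, cone_single]
    congr 1
    funext i
    refine Fin.cases ?_ (fun j => ?_) i <;> simp
  exact LinearMap.congr_fun this c

lemma boundary_cone_zero (b : E) (c : TupleChain E 0) : boundary E 0 (cone b 0 c) = c := by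
  have : boundary E 0 ∘ₗ cone b 0 = LinearMap.id := hom_ext fun v => by
    simp only [LinearMap.comp_apply, cone_single, boundary_single]
    simp [Subsingleton.elim (fun j : Fin 0 => _) v]
  exact LinearMap.congr_fun this c

lemma boundary_cone (b : E) (c : TupleChain E (n + 1)) :
    boundary E (n + 1) (cone b (n + 1) c) = c - cone b n (boundary E n c) := by
  have : boundary E (n + 1) ∘ₗ cone b (n + 1) = LinearMap.id - cone b n ∘ₗ boundary E n :=
    hom_ext fun v => by
      simp only [LinearMap.comp_apply, cone_single, boundary_single, LinearMap.sub_apply,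
        LinearMap.id_apply, map_sum, map_smul]
      rw [Fin.sum_univ_succ, sub_eq_add_neg, ← Finset.sum_neg_distrib]
      congr 1
      · simp
      · refine Finset.sum_congr rfl fun i _ => ?_
        have : (fun j => (Fin.cons b v : Fin (n + 2) → E) (i.succ.succAbove j)) =
            Fin.cons b (fun j => v (i.succAbove j)) := by
          funext j
          refine Fin.cases ?_ (fun j => ?_) j <;> simp
        rw [this, Fin.val_succ, pow_succ, mul_neg_one, neg_smul]
  exact LinearMap.congr_fun this c

lemma single_eq_cone (v : Fin (n + 1) → E) :
    (Finsupp.single v 1 : TupleChain E (n + 1)) = cone (v 0) n (Finsupp.single (Fin.tail v) 1) := by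
  simp

lemma boundary_boundary : ∀ (n : ℕ) (c : TupleChain E (n + 2)),
    boundary E n (boundary E (n + 1) c) = 0 := by
  intro n
  induction n with
  | zero =>
    intro c
    have : boundary E 0 ∘ₗ boundary E 1 = 0 := hom_ext fun v => by
      rw [LinearMap.comp_apply, single_eq_cone, boundary_cone, map_sub, boundary_cone_zero,
        sub_self, LinearMap.zero_apply]
    exact LinearMap.congr_fun this c
  | succ n ih =>
    intro c
    have : boundary E (n + 1) ∘ₗ boundary E (n + 2) = 0 := hom_ext fun v => by
      rw [LinearMap.comp_apply, single_eq_cone, boundary_cone, map_sub, boundary_cone, ih,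
        map_zero, sub_zero, sub_self, LinearMap.zero_apply]
    exact LinearMap.congr_fun this c

/-! ### Supports of tuple chains -/

/-- The chains all of whose tuples satisfy `P`. -/
def supported (P : (Fin n → E) → Prop) : Submodule ℤ (TupleChain E n) :=
  Finsupp.supported ℤ ℤ {v | P v}

lemma single_mem_supported {P : (Fin n → E) → Prop} {v : Fin n → E} (h : P v) (a : ℤ) :
    Finsupp.single v a ∈ supported P :=
  Finsupp.single_mem_supported ℤ a h

lemma supported_mono {P Q : (Fin n → E) → Prop} (h : ∀ v, P v → Q v) :
    supported P ≤ supported Q :=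
  Finsupp.supported_mono h

/-- A linear map sends chains supported on `P` into a submodule as soon as it sends the tuples
satisfying `P` there. -/
lemma map_mem_of_supported {M : Type*} [AddCommGroup M] {P : (Fin n → E) → Prop}
    (f : TupleChain E n →ₗ[ℤ] M) (N : Submodule ℤ M)
    (h : ∀ v, P v → f (Finsupp.single v 1) ∈ N) {c : TupleChain E n} (hc : c ∈ supported P) :
    f c ∈ N := by
  have : supported P ≤ N.comap f := by
    rw [supported, Finsupp.supported_eq_span_single, Submodule.span_le]
    rintro _ ⟨v, hv, rfl⟩
    exact h v hv
  exact this hc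

lemma eq_zero_of_supported {M : Type*} [AddCommGroup M] {P : (Fin n → E) → Prop}
    (f : TupleChain E n →ₗ[ℤ] M) (h : ∀ v, P v → f (Finsupp.single v 1) = 0)
    {c : TupleChain E n} (hc : c ∈ supported P) : f c = 0 := by
  simpa using map_mem_of_supported f ⊥ (by simpa using h) hc

lemma map_congr_of_supported {P : (Fin n → E) → Prop} {g g' : E → E'}
    (h : ∀ v, P v → ∀ i, g (v i) = g' (v i)) {c : TupleChain E n} (hc : c ∈ supported P) :
    map g n c = map g' n c := by
  rw [← sub_eq_zero, ← LinearMap.sub_apply]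
  refine eq_zero_of_supported _ (fun v hv => ?_) hc
  rw [LinearMap.sub_apply, map_single, map_single, sub_eq_zero]
  congr 1
  exact funext (h v hv)

/-- The predicate that all entries of a tuple lie in `s`. -/
abbrev In (s : Set E) : (Fin n → E) → Prop := fun v => ∀ i, v i ∈ s

lemma boundary_mem {s : Set E} {c : TupleChain E (n + 1)} (hc : c ∈ supported (In s)) :
    boundary E n c ∈ supported (In s) := by
  refine map_mem_of_supported _ _ (fun v hv => ?_) hc
  rw [boundary_single]
  exact Submodule.sum_mem _ fun i _ => Submodule.smul_mem _ _
    (single_mem_supported (fun j => hv _) _)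

lemma cone_mem {s : Set E} {b : E} (hb : b ∈ s) {c : TupleChain E n} (hc : c ∈ supported (In s)) :
    cone b n c ∈ supported (In s) := by
  refine map_mem_of_supported _ _ (fun v hv => ?_) hc
  rw [cone_single]
  refine single_mem_supported (fun i => ?_) _
  refine Fin.cases ?_ (fun j => ?_) i
  · simpa using hb
  · simpa using hv j

/-! ### Barycentric subdivision -/

section Subdivision

variable [AddCommGroup E] [Module ℝ E]

/-- The barycentre of a tuple of points. -/
def barycentre (v : Fin (n + 1) → E) : E := ((n + 1 : ℝ)⁻¹) • ∑ i, v i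

/-- Barycentric subdivision of tuple chains: the subdivision of a tuple is the cone from its
barycentre over the subdivision of its boundary. -/
def sd (E : Type*) [AddCommGroup E] [Module ℝ E] (n : ℕ) : TupleChain E n →ₗ[ℤ] TupleChain E n :=
  Nat.rec (motive := fun n => TupleChain E n →ₗ[ℤ] TupleChain E n) LinearMap.id
    (fun n sdn => Finsupp.linearCombination ℤ fun v =>
      cone (barycentre v) n (sdn (boundary E n (Finsupp.single v 1)))) n

lemma sd_single (v : Fin (n + 1) → E) :
    sd E (n + 1) (Finsupp.single v 1) =
      cone (barycentre v) n (sd E n (boundary E n (Finsupp.single v 1))) := by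
  simp [sd]

lemma boundary_sd : ∀ (n : ℕ) (c : TupleChain E (n + 1)),
    boundary E n (sd E (n + 1) c) = sd E n (boundary E n c) := by
  intro n
  induction n with
  | zero =>
    intro c
    have : boundary E 0 ∘ₗ sd E 1 = sd E 0 ∘ₗ boundary E 0 := hom_ext fun v => by
      rw [LinearMap.comp_apply, sd_single, boundary_cone_zero, LinearMap.comp_apply]
    exact LinearMap.congr_fun this c
  | succ n ih =>
    intro c
    have : boundary E (n + 1) ∘ₗ sd E (n + 2) = sd E (n + 1) ∘ₗ boundary E (n + 1) :=
      hom_ext fun v => by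
        rw [LinearMap.comp_apply, sd_single, boundary_cone, ih, boundary_boundary, map_zero,
          map_zero, sub_zero, LinearMap.comp_apply]
    exact LinearMap.congr_fun this c

lemma sd_map [AddCommGroup E'] [Module ℝ E'] (g : E →ₗ[ℝ] E') : ∀ (n : ℕ) (c : TupleChain E n),
    sd E' n (map g n c) = map g n (sd E n c) := by
  intro n
  induction n with
  | zero => intro c; rfl
  | succ n ih =>
    intro c
    have : sd E' (n + 1) ∘ₗ map g (n + 1) = map g (n + 1) ∘ₗ sd E (n + 1) := hom_ext fun v => by
      have hb : barycentre (g ∘ v) = g (barycentre v) := by simp [barycentre]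
      rw [LinearMap.comp_apply, map_single, sd_single, ← map_single, boundary_map, ih, hb,
        LinearMap.comp_apply, sd_single, map_cone]
    exact LinearMap.congr_fun this c

lemma barycentre_mem {s : Set E} (hs : Convex ℝ s) {v : Fin (n + 1) → E} (hv : In s v) :
    barycentre v ∈ s := by
  rw [barycentre, Finset.smul_sum]
  refine hs.sum_mem (fun _ _ => by positivity) ?_ fun i _ => hv i
  simp only [Finset.sum_const, Finset.card_univ, Fintype.card_fin, nsmul_eq_mul]
  push_cast
  field_simp

lemma sd_mem {s : Set E} (hs : Convex ℝ s) : ∀ (n : ℕ) {c : TupleChain E n},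
    c ∈ supported (In s) → sd E n c ∈ supported (In s) := by
  intro n
  induction n with
  | zero => exact fun hc => hc
  | succ n ih =>
    intro c hc
    refine map_mem_of_supported _ _ (fun v hv => ?_) hc
    rw [sd_single]
    exact cone_mem (barycentre_mem hs hv) (ih (boundary_mem (single_mem_supported hv 1)))

lemma boundary_sd_iterate (k n : ℕ) (c : TupleChain E (n + 1)) :
    boundary E n ((sd E (n + 1))^[k] c) = (sd E n)^[k] (boundary E n c) := by
  induction k generalizing c with
  | zero => rfl
  | succ k ih => rw [Function.iterate_succ_apply, ih, boundary_sd, Function.iterate_succ_apply]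

lemma sd_iterate_map [AddCommGroup E'] [Module ℝ E'] (g : E →ₗ[ℝ] E') (k n : ℕ)
    (c : TupleChain E n) : (sd E' n)^[k] (map g n c) = map g n ((sd E n)^[k] c) := by
  induction k generalizing c with
  | zero => rfl
  | succ k ih => rw [Function.iterate_succ_apply, sd_map, ih, Function.iterate_succ_apply]

lemma sd_iterate_mem {s : Set E} (hs : Convex ℝ s) (k n : ℕ) {c : TupleChain E n}
    (hc : c ∈ supported (In s)) : (sd E n)^[k] c ∈ supported (In s) := by
  induction k generalizing c with
  | zero => exact hc
  | succ k ih => exact ih (sd_mem hs n hc)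

end Subdivision

/-! ### Small tuples -/

section Small

variable [NormedAddCommGroup E] [NormedSpace ℝ E]

/-- The predicate that any two entries of a tuple have distance at most `r`. -/
abbrev Small (r : ℝ) : (Fin n → E) → Prop := fun v => ∀ i j, dist (v i) (v j) ≤ r

/-- The barycentre of an `(n + 1)`-tuple of pairwise distance at most `r` has distance at most
`n / (n + 1) * r` from each entry, because that entry itself contributes `0` to the mean of the
distances. -/
lemma dist_barycentre_le {r : ℝ} {v : Fin (n + 1) → E} (hv : Small r v) (j : Fin (n + 1)) :
    dist (barycentre v) (v j) ≤ n / (n + 1 : ℝ) * r := by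
  have h1 : barycentre v - v j = ((n + 1 : ℝ)⁻¹) • ∑ i, (v i - v j) := by
    rw [barycentre, Finset.sum_sub_distrib, smul_sub]
    congr 1
    simp only [Finset.sum_const, Finset.card_univ, Fintype.card_fin, ← Nat.cast_smul_eq_nsmul ℝ,
      smul_smul]
    push_cast
    rw [inv_mul_cancel₀ (by positivity), one_smul]
  have h2 : ‖∑ i, (v i - v j)‖ ≤ n * r := by
    rw [Fin.sum_univ_succAbove _ j, sub_self, zero_add]
    refine (norm_sum_le _ _).trans ?_
    calc ∑ i : Fin n, ‖v (j.succAbove i) - v j‖ ≤ ∑ _i : Fin n, r :=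
          Finset.sum_le_sum fun i _ => by rw [← dist_eq_norm]; exact hv _ _
      _ = n * r := by simp
  rw [dist_eq_norm, h1, norm_smul, Real.norm_of_nonneg (by positivity)]
  calc ((n + 1 : ℝ)⁻¹) * ‖∑ i, (v i - v j)‖ ≤ ((n + 1 : ℝ)⁻¹) * (n * r) := by gcongr
    _ = n / (n + 1 : ℝ) * r := by ring

/-- Subdividing an `n`-tuple shrinks distances by the factor `(n - 1) / n`; the truncated
subtraction and the division by `0` are harmless for `n = 0`. -/
lemma sd_small_mem {r : ℝ} (hr : 0 ≤ r) : ∀ (n : ℕ) {c : TupleChain E n},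
    c ∈ supported (Small r) → sd E n c ∈ supported (Small (((n - 1 : ℕ) : ℝ) / n * r)) := by
  intro n
  induction n with
  | zero => exact fun {c} hc => supported_mono (fun v _ i => i.elim0) hc
  | succ n ih =>
    intro c hc
    refine map_mem_of_supported _ _ (fun v hv => ?_) hc
    have hmono : ((n - 1 : ℕ) : ℝ) / n * r ≤ n / (n + 1 : ℝ) * r := by
      refine mul_le_mul_of_nonneg_right ?_ hr
      rcases n with _ | n
      · simp
      · rw [Nat.add_sub_cancel]
        push_cast
        rw [div_le_div_iff₀ (by positivity) (by positivity)]
        nlinarith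
    -- Each tuple of the subdivided boundary is small, and lies in the ball around the barycentre.
    have h1 : sd E n (boundary E n (Finsupp.single v 1)) ∈
        supported (Small (n / (n + 1 : ℝ) * r)) := by
      refine supported_mono (fun w hw i j => (hw i j).trans hmono) (ih ?_)
      rw [boundary_single]
      exact Submodule.sum_mem _ fun i _ => Submodule.smul_mem _ _
        (single_mem_supported (fun _ _ => hv _ _) _)
    have h2 : sd E n (boundary E n (Finsupp.single v 1)) ∈
        supported (In (Metric.closedBall (barycentre v) (n / (n + 1 : ℝ) * r))) := by
      refine sd_mem (convex_closedBall _ _) n (boundary_mem (single_mem_supported (fun j => ?_) 1))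
      rw [Metric.mem_closedBall, dist_comm]
      exact dist_barycentre_le hv j
    have h3 : sd E n (boundary E n (Finsupp.single v 1)) ∈ supported (fun w : Fin n → E =>
        Small (n / (n + 1 : ℝ) * r) w ∧
          In (Metric.closedBall (barycentre v) (n / (n + 1 : ℝ) * r)) w) := by
      rw [supported, Finsupp.mem_supported] at h1 h2 ⊢
      exact fun w hw => ⟨h1 hw, h2 hw⟩
    rw [sd_single]
    refine map_mem_of_supported _ _ (fun w hw => ?_) h3
    rw [cone_single]
    refine single_mem_supported ?_ _
    have h0 : (0 : ℝ) ≤ n / (n + 1 : ℝ) * r := by positivity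
    intro i j
    rw [Nat.add_sub_cancel]
    push_cast
    refine Fin.cases ?_ (fun i => ?_) i <;> refine Fin.cases ?_ (fun j => ?_) j
    · simpa using h0
    · rw [Fin.cons_zero, Fin.cons_succ, dist_comm]; exact hw.2 j
    · rw [Fin.cons_zero, Fin.cons_succ]; exact hw.2 i
    · rw [Fin.cons_succ, Fin.cons_succ]; exact hw.1 i j

lemma sd_iterate_small_mem {r : ℝ} (hr : 0 ≤ r) (k n : ℕ) {c : TupleChain E n}
    (hc : c ∈ supported (Small r)) :
    (sd E n)^[k] c ∈ supported (Small ((((n - 1 : ℕ) : ℝ) / n) ^ k * r)) := by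
  induction k with
  | zero => simpa using hc
  | succ k ih =>
    rw [Function.iterate_succ_apply', pow_succ', mul_assoc]
    exact sd_small_mem (by positivity) n ih

/-- Iterated barycentric subdivision makes every tuple arbitrarily small. -/
lemma exists_sd_iterate_small {δ : ℝ} (hδ : 0 < δ) {r : ℝ} (hr : 0 ≤ r) (n : ℕ)
    {c : TupleChain E n} (hc : c ∈ supported (Small r)) :
    ∃ K, ∀ k ≥ K, (sd E n)^[k] c ∈ supported (Small δ) := by
  have hlt : ((n - 1 : ℕ) : ℝ) / n < 1 := by
    rcases n with _ | n
    · simp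
    · rw [div_lt_one (by positivity)]; simp
  have := (tendsto_pow_atTop_nhds_zero_of_lt_one (by positivity) hlt).mul_const r
  rw [zero_mul] at this
  obtain ⟨K, hK⟩ := Filter.eventually_atTop.1 (this.eventually (gt_mem_nhds hδ))
  exact ⟨K, fun k hk => supported_mono (fun v hv i j => (hv i j).trans (hK k hk).le)
    (sd_iterate_small_mem hr k n hc)⟩

end Small

/-! ### A carrier homotopy -/

/-- A homotopy from the identity to an augmentation preserving chain endomorphism `α` of the tuple
chains: the homotopy of a tuple is a cone with apex its first entry. -/
def carrierHomotopy (α : ∀ n, TupleChain E n →ₗ[ℤ] TupleChain E n) (n : ℕ) :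
    TupleChain E n →ₗ[ℤ] TupleChain E (n + 1) :=
  Nat.rec (motive := fun n => TupleChain E n →ₗ[ℤ] TupleChain E (n + 1)) 0
    (fun n T => Finsupp.linearCombination ℤ fun v =>
      cone (v 0) (n + 1) (Finsupp.single v 1 - α (n + 1) (Finsupp.single v 1) -
        T (boundary E n (Finsupp.single v 1)))) n

lemma carrierHomotopy_single (α : ∀ n, TupleChain E n →ₗ[ℤ] TupleChain E n)
    (v : Fin (n + 1) → E) :
    carrierHomotopy α (n + 1) (Finsupp.single v 1) =
      cone (v 0) (n + 1) (Finsupp.single v 1 - α (n + 1) (Finsupp.single v 1) -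
        carrierHomotopy α n (boundary E n (Finsupp.single v 1))) := by
  simp [carrierHomotopy]

lemma boundary_carrierHomotopy (α : ∀ n, TupleChain E n →ₗ[ℤ] TupleChain E n)
    (h0 : ∀ c, α 0 c = c)
    (hα : ∀ n (c : TupleChain E (n + 1)), boundary E n (α (n + 1) c) = α n (boundary E n c)) :
    ∀ (n : ℕ) (c : TupleChain E (n + 1)),
      boundary E (n + 1) (carrierHomotopy α (n + 1) c) =
        c - α (n + 1) c - carrierHomotopy α n (boundary E n c) := by
  intro n
  induction n with
  | zero =>
    intro c
    have : boundary E 1 ∘ₗ carrierHomotopy α 1 =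
        LinearMap.id - α 1 - carrierHomotopy α 0 ∘ₗ boundary E 0 := hom_ext fun v => by
      simp only [LinearMap.comp_apply, LinearMap.sub_apply, LinearMap.id_apply]
      rw [carrierHomotopy_single, boundary_cone]
      simp [hα, h0, carrierHomotopy]
    exact LinearMap.congr_fun this c
  | succ n ih =>
    intro c
    have : boundary E (n + 2) ∘ₗ carrierHomotopy α (n + 2) =
        LinearMap.id - α (n + 2) - carrierHomotopy α (n + 1) ∘ₗ boundary E (n + 1) :=
      hom_ext fun v => by
        simp only [LinearMap.comp_apply, LinearMap.sub_apply, LinearMap.id_apply]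
        rw [carrierHomotopy_single, boundary_cone, map_sub, map_sub (boundary E (n + 1)), ih,
          boundary_boundary, hα]
        simp
    exact LinearMap.congr_fun this c

lemma carrierHomotopy_mem {α : ∀ n, TupleChain E n →ₗ[ℤ] TupleChain E n} {s : Set E}
    (hα : ∀ n (c : TupleChain E n), c ∈ supported (In s) → α n c ∈ supported (In s)) :
    ∀ (n : ℕ) {c : TupleChain E n}, c ∈ supported (In s) →
      carrierHomotopy α n c ∈ supported (In s) := by
  intro n
  induction n with
  | zero => exact fun _ => Submodule.zero_mem _
  | succ n ih =>
    intro c hc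
    refine map_mem_of_supported _ _ (fun v hv => ?_) hc
    have hv' : Finsupp.single v 1 ∈ supported (In s) := single_mem_supported hv 1
    rw [carrierHomotopy_single]
    exact cone_mem (hv 0) (Submodule.sub_mem _ (Submodule.sub_mem _ hv' (hα _ _ hv'))
      (ih (boundary_mem hv')))

/-! ### The determinant cochain -/

/-- The cochain that sends an `N`-tuple of points of `ℝ ^ N` to its determinant. On tuples in the
hyperplane of coordinate sum `1` it is a multiple of the oriented volume. -/
def detCochain (N : ℕ) : TupleChain (Fin N → ℝ) N →ₗ[ℤ] ℝ :=
  Finsupp.linearCombination ℤ fun v => (Matrix.of v).det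

variable {N : ℕ}

lemma detCochain_single (v : Fin N → Fin N → ℝ) :
    detCochain N (Finsupp.single v 1) = (Matrix.of v).det := by
  simp [detCochain]

/-- On the hyperplane of coordinate sum `1`, the determinant is a cocycle: its coboundary is the
determinant of a matrix whose columns are linearly dependent. -/
lemma detCochain_boundary {c : TupleChain (Fin N → ℝ) (N + 1)}
    (hc : c ∈ supported (In {x | ∑ i, x i = 1})) :
    detCochain N (boundary _ N c) = 0 := by
  refine eq_zero_of_supported (detCochain N ∘ₗ boundary _ N) (fun v hv => ?_) hc
  let A : Matrix (Fin (N + 1)) (Fin (N + 1)) ℝ := Matrix.of fun i => Fin.cons 1 (v i)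
  have hA : A.det = 0 := by
    refine Matrix.exists_mulVec_eq_zero_iff.1 ⟨Fin.cons (-1) fun _ => 1, ?_, ?_⟩
    · intro h
      simpa using congrFun h 0
    · funext i
      have := hv i
      simp only [Set.mem_ofPred_eq] at this
      simp [A, Matrix.mulVec, dotProduct, Fin.sum_univ_succ, this]
  rw [LinearMap.comp_apply, boundary_single, map_sum, ← hA, Matrix.det_succ_column_zero]
  refine Finset.sum_congr rfl fun i _ => ?_
  rw [map_smul, detCochain_single, zsmul_eq_mul]
  have h1 : A i 0 = 1 := rfl
  have h2 : A.submatrix i.succAbove Fin.succ = Matrix.of fun j => v (i.succAbove j) := rfl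
  rw [h1, h2]
  push_cast
  ring

lemma detCochain_eq_zero_of_face (i : Fin N) {c : TupleChain (Fin N → ℝ) N}
    (hc : c ∈ supported (In {x | x i = 0})) : detCochain N c = 0 := by
  refine eq_zero_of_supported _ (fun v hv => ?_) hc
  rw [detCochain_single]
  exact Matrix.det_eq_zero_of_column_eq_zero i hv

lemma detCochain_eq_zero_of_cycle {c : TupleChain (Fin (N + 1) → ℝ) (N + 1)}
    (hc : c ∈ supported (In {x | ∑ i, x i = 1})) (hb : boundary _ N c = 0) :
    detCochain (N + 1) c = 0 := by
  have h1 : boundary _ _ (cone (Pi.single 0 1 : Fin (N + 1) → ℝ) _ c) = c := by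
    rw [boundary_cone, hb, map_zero, sub_zero]
  rw [← h1]
  exact detCochain_boundary (cone_mem (by simp) hc)

/-- The tuple of the vertices of the standard simplex. -/
def vertices (N : ℕ) : TupleChain (Fin N → ℝ) N :=
  Finsupp.single (fun i => Pi.single i 1) 1

lemma vertices_mem (N : ℕ) : vertices N ∈ supported (In (stdSimplex ℝ (Fin N))) :=
  single_mem_supported (fun i => single_mem_stdSimplex ℝ i) 1

/-- An algebraic form of Sperner's lemma: if a chain endomorphism `α` preserves the standard
simplex and each of its facets, then `α` does not change the total volume `1` of the simplex. -/
lemma detCochain_vertices (α : ∀ n, TupleChain (Fin N → ℝ) n →ₗ[ℤ] TupleChain (Fin N → ℝ) n)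
    (h0 : ∀ c, α 0 c = c)
    (hb : ∀ n c, boundary _ n (α (n + 1) c) = α n (boundary _ n c))
    (hΔ : ∀ n c, c ∈ supported (In (stdSimplex ℝ (Fin N))) →
      α n c ∈ supported (In (stdSimplex ℝ (Fin N))))
    (hF : ∀ i n c, c ∈ supported (In (stdSimplex ℝ (Fin N) ∩ {x | x i = 0})) →
      α n c ∈ supported (In (stdSimplex ℝ (Fin N) ∩ {x | x i = 0}))) :
    detCochain N (α N (vertices N)) = 1 := by
  have hdet : detCochain N (vertices N) = 1 := by
    rw [vertices, detCochain_single, ← Matrix.det_one (n := Fin N)]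
    congr 1
    ext i j
    simp [Matrix.one_apply, Pi.single_apply, eq_comm]
  rcases N with _ | n
  · rw [h0, hdet]
  have hT := boundary_carrierHomotopy α h0 hb n (vertices (n + 1))
  have h1 : detCochain (n + 1) (boundary _ (n + 1) (carrierHomotopy α (n + 1) (vertices _))) = 0 :=
    detCochain_boundary (supported_mono (fun v hv i => (hv i).2)
      (carrierHomotopy_mem hΔ _ (vertices_mem _)))
  have h2 : detCochain (n + 1) (carrierHomotopy α n (boundary _ n (vertices _))) = 0 := by
    rw [vertices, boundary_single, map_sum, map_sum]
    refine Finset.sum_eq_zero fun i _ => ?_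
    rw [map_smul, map_smul, detCochain_eq_zero_of_face i, smul_zero]
    refine supported_mono (fun v hv j => (hv j).2) (carrierHomotopy_mem (hF i) n
      (single_mem_supported (fun j => ⟨single_mem_stdSimplex ℝ _, ?_⟩) 1))
    simp [(Fin.succAbove_ne i j).symm]
  rw [hT, map_sub, map_sub, h2, hdet] at h1
  linarith

end TupleChain

/-! ### Cycles and homology classes of complexes of abelian groups -/

section Complexes

variable {K L : ChainComplex AddCommGrpCat.{u} ℕ} {n : ℕ}

lemma exists_iCycles_eq (x : K.X n) (hx : ∀ j, K.d n j x = 0) :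
    ∃ z : K.cycles n, K.iCycles n z = x := by
  let g : integers.{u} ⟶ K.X n :=
    AddCommGrpCat.ofHom ((zmultiplesHom _ x).comp AddEquiv.ulift.toAddMonoidHom)
  have hg : g ≫ K.d n ((ComplexShape.down ℕ).next n) = 0 := by
    ext
    simp [g, hx]
  refine ⟨K.liftCycles g _ rfl hg (ULift.up 1), ?_⟩
  rw [← ConcreteCategory.comp_apply, HomologicalComplex.liftCycles_i]
  simp only [g, AddCommGrpCat.hom_ofHom, AddMonoidHom.comp_apply]
  exact one_smul ℤ x

lemma exists_d_eq_of_homologyπ_eq_zero (z : K.cycles n) (hz : K.homologyπ n z = 0) :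
    ∃ w : K.X (n + 1), K.d (n + 1) n w = K.iCycles n z := by
  have hex := ShortComplex.exact_of_g_is_cokernel
    (ShortComplex.mk (K.toCycles (n + 1) n) (K.homologyπ n) (by simp))
    (K.homologyIsCokernel (n + 1) n (by simp))
  obtain ⟨w, hw⟩ := (ShortComplex.ab_exact_iff _).1 hex z hz
  refine ⟨w, ?_⟩
  rw [← hw, ← K.toCycles_i (n + 1) n, ConcreteCategory.comp_apply]

lemma iCycles_injective : Function.Injective (K.iCycles n) :=
  (AddCommGrpCat.mono_iff_injective _).1 inferInstance

lemma homologyπ_surjective : Function.Surjective (K.homologyπ n) :=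
  (AddCommGrpCat.epi_iff_surjective _).1 inferInstance

lemma d_iCycles (z : K.cycles n) (j : ℕ) : K.d n j (K.iCycles n z) = 0 := by
  rw [← ConcreteCategory.comp_apply, K.iCycles_d]
  rfl

end Complexes

/-! ### Singular chains as formal sums of simplices -/

section Singular

variable {X Y : TopCat.{u}} {m : ℕ}

/-- The chain map that a continuous map induces on singular chains. -/
abbrev chainMap (f : X ⟶ Y) : singularChains X ⟶ singularChains Y :=
  ((singularChainComplexFunctor AddCommGrpCat.{u}).obj integers.{u}).map f

/-- The `i`-th face of a singular simplex. -/
def simplexFace {X : Type*} [TopologicalSpace X] (i : Fin (m + 2))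
    (σ : C(stdSimplex ℝ (Fin (m + 2)), X)) : C(stdSimplex ℝ (Fin (m + 1)), X) :=
  σ.comp ⟨stdSimplex.map i.succAbove, stdSimplex.continuous_map _⟩

lemma simplexChain_zero (σ : C(stdSimplex ℝ (Fin (m + 1)), X)) : simplexChain 0 σ = 0 :=
  map_zero (AddCommGrpCat.Hom.hom _)

lemma simplexChain_add (a b : ℤ) (σ : C(stdSimplex ℝ (Fin (m + 1)), X)) :
    simplexChain (a + b) σ = simplexChain a σ + simplexChain b σ :=
  map_add (AddCommGrpCat.Hom.hom
    (SSet.ιChainComplex (R := integers.{u}) (TopCat.toSSet.obj X)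
      ((TopCat.toSSetObjEquiv X (op ⦋m⦌)).symm σ))) (ULift.up a) (ULift.up b)

/-- The coefficients of a singular chain. -/
def coefficients (X : TopCat.{u}) (m : ℕ) :
    (singularChains X).X m ⟶ AddCommGrpCat.of (C(stdSimplex ℝ (Fin (m + 1)), X) →₀ ℤ) :=
  Limits.Cofan.IsColimit.desc
    (SSet.isColimitChainComplexXCofan (TopCat.toSSet.obj X) integers.{u} m) fun s =>
      AddCommGrpCat.ofHom ((Finsupp.singleAddHom (TopCat.toSSetObjEquiv X (op ⦋m⦌) s)).comp
        AddEquiv.ulift.toAddMonoidHom)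

lemma coefficients_simplexChain (a : ℤ) (σ : C(stdSimplex ℝ (Fin (m + 1)), X)) :
    coefficients X m (simplexChain a σ) = Finsupp.single σ a := by
  have := Limits.Cofan.IsColimit.fac
    (SSet.isColimitChainComplexXCofan (TopCat.toSSet.obj X) integers.{u} m)
    (fun s => AddCommGrpCat.ofHom ((Finsupp.singleAddHom (M := ℤ)
      (TopCat.toSSetObjEquiv X (op ⦋m⦌) s)).comp AddEquiv.ulift.toAddMonoidHom))
    ((TopCat.toSSetObjEquiv X (op ⦋m⦌)).symm σ)
  have h2 := ConcreteCategory.congr_hom this (ULift.up a)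
  rw [ConcreteCategory.comp_apply] at h2
  refine h2.trans ?_
  rw [Equiv.apply_symm_apply]
  rfl

lemma chain_hom_ext {A : AddCommGrpCat.{u}} {f g : (singularChains X).X m ⟶ A}
    (h : ∀ a σ, f (simplexChain a σ) = g (simplexChain a σ)) : f = g := by
  refine SSet.chainComplex_hom_ext fun s => ?_
  ext a
  have := h a.down (TopCat.toSSetObjEquiv X (op ⦋m⦌) s)
  simp only [simplexChain, Equiv.symm_apply_apply] at this
  exact this

/-- A finite sum can be indexed by `Fin k`. -/
lemma exists_sum_eq_sum_fin {ι A : Type*} [AddCommMonoid A] (s : Finset ι) (f : ι → A) :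
    ∃ (k : ℕ) (e : Fin k → ι), ∑ i ∈ s, f i = ∑ j, f (e j) :=
  ⟨_, fun j => s.equivFin.symm j, by
    rw [← Finset.sum_coe_sort]
    exact (Equiv.sum_comp s.equivFin.symm fun i : s => f i).symm⟩

lemma exists_eq_sum_simplexChain (x : (singularChains X).X m) :
    ∃ (k : ℕ) (a : Fin k → ℤ) (σ : Fin k → C(stdSimplex ℝ (Fin (m + 1)), X)),
      x = ∑ i, simplexChain (a i) (σ i) := by
  let N : (C(stdSimplex ℝ (Fin (m + 1)), X) →₀ ℤ) →+ (singularChains X).X m :=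
    Finsupp.liftAddHom fun σ =>
      { toFun := fun a => simplexChain a σ
        map_zero' := simplexChain_zero σ
        map_add' := fun a b => simplexChain_add a b σ }
  have h : coefficients X m ≫ AddCommGrpCat.ofHom N = 𝟙 _ := chain_hom_ext fun a σ => by
    rw [ConcreteCategory.comp_apply, coefficients_simplexChain]
    simp [N, simplexChain_zero]
  have hx : x = ∑ σ ∈ (coefficients X m x).support, simplexChain (coefficients X m x σ) σ := by
    have := ConcreteCategory.congr_hom h x
    rw [ConcreteCategory.comp_apply] at this
    exact this.symm
  obtain ⟨k, e, he⟩ := exists_sum_eq_sum_fin (coefficients X m x).support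
    fun σ => simplexChain (coefficients X m x σ) σ
  exact ⟨k, _, e, hx.trans he⟩

lemma chainMap_simplexChain (f : X ⟶ Y) (a : ℤ) (σ : C(stdSimplex ℝ (Fin (m + 1)), X)) :
    (chainMap f).f m (simplexChain a σ) = simplexChain a (f.hom.comp σ) := by
  have := ConcreteCategory.congr_hom (SSet.ι_chainComplexMap_f _ _ (TopCat.toSSet.map f)
    integers.{u} ((TopCat.toSSetObjEquiv X (op ⦋m⦌)).symm σ)) (ULift.up a)
  rw [ConcreteCategory.comp_apply] at this
  exact this

lemma d_simplexChain (a : ℤ) (σ : C(stdSimplex ℝ (Fin (m + 2)), X)) :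
    (singularChains X).d (m + 1) m (simplexChain a σ) =
      ∑ i : Fin (m + 2), (-1 : ℤ) ^ (i : ℕ) • simplexChain a (simplexFace i σ) := by
  have := ConcreteCategory.congr_hom (SSet.ιChainComplex_d (R := integers.{u})
    (TopCat.toSSet.obj X) ((TopCat.toSSetObjEquiv X (op ⦋m + 1⦌)).symm σ)) (ULift.up a)
  rw [ConcreteCategory.comp_apply] at this
  refine this.trans ?_
  let ev : (integers.{u} ⟶ (singularChains X).X m) →+ (singularChains X).X m :=
    (AddMonoidHom.eval (ULift.up a)).comp AddCommGrpCat.homAddEquiv.toAddMonoidHom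
  refine (map_sum ev _ _).trans (Finset.sum_congr rfl fun i _ => ?_)
  exact map_zsmul ev _ _

/-! ### Chains with image in a subspace -/

/-- The inclusion of a subspace. -/
def subspaceMap (K : Set X) : TopCat.of K ⟶ X := TopCat.ofHom ⟨Subtype.val, continuous_subtype_val⟩

instance (K : Set X) : Mono (subspaceMap K) :=
  (TopCat.mono_iff_injective _).2 Subtype.val_injective

lemma chainMap_subspaceMap_injective (K : Set X) (j : ℕ) :
    Function.Injective ((chainMap (subspaceMap K)).f j) :=
  (AddCommGrpCat.mono_iff_injective _).1 inferInstance

/-- A singular cycle whose simplices lie in a subspace is a cycle of that subspace. -/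
lemma exists_cycle_of_range_subset (K : Set X) {x : (singularChains X).X m}
    (hx : ∀ j, (singularChains X).d m j x = 0) {k : ℕ} (a : Fin k → ℤ)
    (σ : Fin k → C(stdSimplex ℝ (Fin (m + 1)), X)) (hxσ : x = ∑ i, simplexChain (a i) (σ i))
    (hσ : ∀ i, Set.range (σ i) ⊆ K) :
    ∃ z : (singularChains (TopCat.of K)).cycles m,
      (chainMap (subspaceMap K)).f m ((singularChains (TopCat.of K)).iCycles m z) = x := by
  let τ : ∀ i, C(stdSimplex ℝ (Fin (m + 1)), TopCat.of K) := fun i =>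
    ⟨fun t => ⟨σ i t, hσ i ⟨t, rfl⟩⟩, by fun_prop⟩
  let y : (singularChains (TopCat.of K)).X m := ∑ i, simplexChain (a i) (τ i)
  have hy : (chainMap (subspaceMap K)).f m y = x := by
    rw [hxσ, map_sum]
    refine Finset.sum_congr rfl fun i _ => ?_
    rw [chainMap_simplexChain]
    rfl
  obtain ⟨z, hz⟩ := exists_iCycles_eq y fun j => by
    apply chainMap_subspaceMap_injective K j
    rw [map_zero, ← ConcreteCategory.comp_apply, ← HomologicalComplex.Hom.comm,
      ConcreteCategory.comp_apply, hy, hx]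
  exact ⟨z, by rw [hz, hy]⟩

/-- A homology class that is represented by a cycle whose simplices lie in `K` comes from `K`. -/
lemma exists_map_eq_of_isRepresentedBy {n k : ℕ} {c : (singularHomology n).obj X}
    {a : Fin k → ℤ} {σ : Fin k → C(stdSimplex ℝ (Fin (n + 1)), X)} (h : IsRepresentedBy c a σ)
    {K : Set X} (hσ : ∀ i, Set.range (σ i) ⊆ K) :
    ∃ c', (singularHomology n).map (subspaceMap K) c' = c := by
  obtain ⟨z, hz, rfl⟩ := h
  obtain ⟨z', hz'⟩ := exists_cycle_of_range_subset K (d_iCycles z) a σ hz hσ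
  refine ⟨(singularChains (TopCat.of K)).homologyπ n z', ?_⟩
  have h1 := ConcreteCategory.congr_hom
    (HomologicalComplex.homologyπ_naturality (chainMap (subspaceMap K)) n) z'
  rw [ConcreteCategory.comp_apply, ConcreteCategory.comp_apply] at h1
  refine h1.trans (congrArg _ (iCycles_injective ?_))
  rw [← ConcreteCategory.comp_apply, HomologicalComplex.cyclesMap_i, ConcreteCategory.comp_apply,
    hz']

lemma exists_isRepresentedBy {n : ℕ} (c : (singularHomology n).obj X) :
    ∃ (k : ℕ) (a : Fin k → ℤ) (σ : Fin k → C(stdSimplex ℝ (Fin (n + 1)), X)),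
      IsRepresentedBy c a σ := by
  obtain ⟨z, hz⟩ := homologyπ_surjective (K := singularChains X) c
  obtain ⟨k, a, σ, h⟩ := exists_eq_sum_simplexChain ((singularChains X).iCycles n z)
  exact ⟨k, a, σ, z, h, hz⟩

end Singular

open TupleChain

/-! ### Sampling singular chains on subdivided simplices -/

section Sampling

variable {E : Type*} {X : TopCat.{u}} {m : ℕ}

/-- A singular simplex as a function on the whole coordinate space, with an irrelevant constant
value off the standard simplex. -/
def extendSimplex {X : Type*} [TopologicalSpace X] (σ : C(stdSimplex ℝ (Fin (m + 1)), X))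
    (x : Fin (m + 1) → ℝ) : X :=
  open Classical in if h : x ∈ stdSimplex ℝ (Fin (m + 1)) then σ ⟨x, h⟩ else
    σ (stdSimplex.vertex 0)

lemma extendSimplex_of_mem {X : Type*} [TopologicalSpace X]
    (σ : C(stdSimplex ℝ (Fin (m + 1)), X)) {x : Fin (m + 1) → ℝ}
    (h : x ∈ stdSimplex ℝ (Fin (m + 1))) : extendSimplex σ x = σ ⟨x, h⟩ :=
  dif_pos h

lemma sd_iterate_vertices_mem (k N : ℕ) :
    (sd _ N)^[k] (vertices N) ∈ supported (In (stdSimplex ℝ (Fin N))) :=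
  sd_iterate_mem (convex_stdSimplex ℝ _) k N (vertices_mem N)

lemma boundary_vertices (m : ℕ) : boundary _ m (vertices (m + 1)) =
    ∑ i : Fin (m + 1), (-1 : ℤ) ^ (i : ℕ) •
      map (FunOnFinite.linearMap ℝ ℝ i.succAbove) m (vertices m) := by
  rw [vertices, boundary_single]
  refine Finset.sum_congr rfl fun i _ => ?_
  rw [vertices, map_single]
  congr 2
  funext j
  have := congrArg Subtype.val (stdSimplex.map_vertex (S := ℝ) i.succAbove j)
  exact this.symm

/-- The tuple chain obtained from a singular simplex by evaluating a function `G` on the vertices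
of the `k`-fold barycentric subdivision. -/
def sampleSimplex (G : X → E) (k : ℕ) (σ : C(stdSimplex ℝ (Fin (m + 1)), X)) :
    TupleChain E (m + 1) :=
  map (G ∘ extendSimplex σ) (m + 1) ((sd _ (m + 1))^[k] (vertices (m + 1)))

lemma boundary_sampleSimplex (G : X → E) (k : ℕ) (σ : C(stdSimplex ℝ (Fin (m + 2)), X)) :
    boundary E (m + 1) (sampleSimplex G k σ) =
      ∑ i : Fin (m + 2), (-1 : ℤ) ^ (i : ℕ) • sampleSimplex G k (simplexFace i σ) := by
  rw [sampleSimplex, boundary_map, boundary_sd_iterate, boundary_vertices,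
    ← Module.End.pow_apply, map_sum, map_sum]
  refine Finset.sum_congr rfl fun i _ => ?_
  rw [map_smul, map_smul, Module.End.pow_apply, sd_iterate_map, map_map, sampleSimplex]
  congr 1
  refine map_congr_of_supported (fun v hv j => ?_) (sd_iterate_vertices_mem k (m + 1))
  simp only [Function.comp_apply]
  rw [extendSimplex_of_mem _ (hv j),
    extendSimplex_of_mem _ (stdSimplex.image_linearMap _ ⟨_, hv j, rfl⟩)]
  rfl

/-- The tuple chain obtained from a singular chain by evaluating a function `G` on the vertices of
the `k`-fold barycentric subdivision. The function `G` need not be continuous. -/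
def sample (G : X → E) (k m : ℕ) : (singularChains X).X m →+ TupleChain E (m + 1) :=
  (Finsupp.liftAddHom fun σ => (zmultiplesHom _ (sampleSimplex G k σ))).comp
    (coefficients X m).hom

lemma sample_simplexChain (G : X → E) (k : ℕ) (a : ℤ) (σ : C(stdSimplex ℝ (Fin (m + 1)), X)) :
    sample G k m (simplexChain a σ) = a • sampleSimplex G k σ := by
  have h : (coefficients X m).hom (simplexChain a σ) = Finsupp.single σ a :=
    coefficients_simplexChain a σ
  rw [sample, AddMonoidHom.comp_apply, h]
  simp

/-- Sampling is a chain map. -/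
lemma boundary_sample (G : X → E) (k : ℕ) (x : (singularChains X).X (m + 1)) :
    boundary E (m + 1) (sample G k (m + 1) x) =
      sample G k m ((singularChains X).d (m + 1) m x) := by
  obtain ⟨l, a, σ, rfl⟩ := exists_eq_sum_simplexChain x
  simp only [map_sum]
  refine Finset.sum_congr rfl fun j _ => ?_
  rw [sample_simplexChain, d_simplexChain, map_smul, boundary_sampleSimplex, Finset.smul_sum,
    map_sum]
  refine Finset.sum_congr rfl fun i _ => ?_
  rw [map_zsmul, sample_simplexChain, smul_comm]

lemma sample_mem {G : X → E} {s : Set E} (hG : ∀ x, G x ∈ s) (k : ℕ)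
    (x : (singularChains X).X m) : sample G k m x ∈ supported (In s) := by
  obtain ⟨l, a, σ, rfl⟩ := exists_eq_sum_simplexChain x
  rw [map_sum]
  refine Submodule.sum_mem _ fun j _ => ?_
  rw [sample_simplexChain]
  refine Submodule.smul_mem _ _ ?_
  refine map_mem_of_supported _ _ (fun v _ => ?_) (sd_iterate_vertices_mem k (m + 1))
  rw [map_single]
  exact single_mem_supported (fun i => hG _) 1

end Sampling

/-! ### The boundary of a simplex has nontrivial homology -/

section Sperner

/-- The index of a largest coordinate. -/
def label {N : ℕ} [NeZero N] (x : Fin N → ℝ) : Fin N := (Finite.exists_max x).choose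

lemma le_label {N : ℕ} [NeZero N] (x : Fin N → ℝ) (i : Fin N) : x i ≤ x (label x) :=
  (Finite.exists_max x).choose_spec i

/-- The vertex of the standard simplex at the index of a largest coordinate. -/
def labelVertex {N : ℕ} [NeZero N] (x : Fin N → ℝ) : Fin N → ℝ := Pi.single (label x) 1

variable {N : ℕ} [NeZero N]

lemma inv_le_label {x : Fin N → ℝ} (hx : x ∈ stdSimplex ℝ (Fin N)) :
    (N : ℝ)⁻¹ ≤ x (label x) := by
  have hN : (0 : ℝ) < N := by exact_mod_cast Nat.pos_of_ne_zero (NeZero.ne N)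
  have : (1 : ℝ) ≤ N * x (label x) := by
    calc (1 : ℝ) = ∑ i, x i := hx.2.symm
      _ ≤ ∑ _i : Fin N, x (label x) := Finset.sum_le_sum fun i _ => le_label x i
      _ = N * x (label x) := by simp
  rw [inv_le_iff_one_le_mul₀ hN]
  linarith

lemma labelVertex_apply_of_lt {x : Fin N → ℝ} (hx : x ∈ stdSimplex ℝ (Fin N)) {i : Fin N}
    (hi : x i < (N : ℝ)⁻¹) : labelVertex x i = 0 := by
  have : label x ≠ i := by
    rintro rfl
    exact absurd (inv_le_label hx) (not_le.2 hi)
  simp [labelVertex, this.symm]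

lemma labelVertex_mem (x : Fin N → ℝ) : labelVertex x ∈ stdSimplex ℝ (Fin N) :=
  single_mem_stdSimplex ℝ _

/-- Sperner's lemma: counted with orientation, the iterated barycentric subdivision of the simplex
has exactly one fully labelled simplex. -/
lemma detCochain_map_labelVertex (k : ℕ) :
    detCochain N (map labelVertex N ((sd _ N)^[k] (vertices N))) = 1 := by
  have hN : (0 : ℝ) < (N : ℝ)⁻¹ := by
    have : (0 : ℝ) < N := by exact_mod_cast Nat.pos_of_ne_zero (NeZero.ne N)
    positivity
  have key : ∀ (s : Set (Fin N → ℝ)), Convex ℝ s → (∀ x ∈ s, labelVertex x ∈ s) →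
      ∀ n (c : TupleChain (Fin N → ℝ) n), c ∈ supported (In s) →
        (map labelVertex n ∘ₗ sd _ n ^ k) c ∈ supported (In s) := by
    intro s hs hg n c hc
    rw [LinearMap.comp_apply, Module.End.pow_apply]
    refine map_mem_of_supported _ _ (fun v hv => ?_) (sd_iterate_mem hs k n hc)
    rw [map_single]
    exact single_mem_supported (fun i => hg _ (hv i)) 1
  have := detCochain_vertices (N := N) (fun n => map labelVertex n ∘ₗ sd _ n ^ k) ?_ ?_ ?_ ?_
  · rwa [LinearMap.comp_apply, Module.End.pow_apply] at this
  · have h0 : map labelVertex 0 ∘ₗ sd (Fin N → ℝ) 0 ^ k = LinearMap.id := by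
      have : sd (Fin N → ℝ) 0 ^ k = LinearMap.id := one_pow k
      rw [this]
      refine hom_ext fun v => ?_
      rw [LinearMap.comp_apply, LinearMap.id_apply, map_single, Subsingleton.elim (_ ∘ v) v]
    exact fun c => LinearMap.congr_fun h0 c
  · intro n c
    rw [LinearMap.comp_apply, LinearMap.comp_apply, boundary_map, Module.End.pow_apply,
      Module.End.pow_apply, boundary_sd_iterate]
  · exact key _ (convex_stdSimplex ℝ _) fun x _ => labelVertex_mem x
  · intro i
    refine key _ ((convex_stdSimplex ℝ _).inter ?_) fun x hx => ⟨labelVertex_mem x, ?_⟩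
    · intro x hx y hy a b _ _ _
      simp only [Set.mem_ofPred_eq] at hx hy
      simp [hx, hy]
    · refine labelVertex_apply_of_lt hx.1 ?_
      have : x i = 0 := hx.2
      rwa [this]

/-- A simplex in the boundary of the standard simplex has no fully labelled small simplices: near
a point whose `i`-th coordinate vanishes, the label `i` does not occur. -/
lemma exists_detCochain_sampleSimplex_eq_zero {X : TopCat.{u}} {n : ℕ}
    {p : X → Fin (n + 2) → ℝ} (hp : Continuous p) (hΔ : ∀ x, p x ∈ stdSimplex ℝ (Fin (n + 2)))
    (hp0 : ∀ x, ∃ i, p x i = 0) (σ : C(stdSimplex ℝ (Fin (n + 2)), X)) :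
    ∃ K, ∀ k ≥ K, detCochain (n + 2) (sampleSimplex (labelVertex ∘ p) k σ) = 0 := by
  let U : Fin (n + 2) → Set (stdSimplex ℝ (Fin (n + 2))) := fun i =>
    {t | p (σ t) i < ((n + 2 : ℕ) : ℝ)⁻¹}
  have hU : ∀ i, IsOpen (U i) := fun i =>
    isOpen_lt ((continuous_apply i).comp (hp.comp σ.continuous)) continuous_const
  have hcov : Set.univ ⊆ ⋃ i, U i := fun t _ => by
    obtain ⟨i, hi⟩ := hp0 (σ t)
    refine Set.mem_iUnion.2 ⟨i, ?_⟩
    simp only [U, Set.mem_ofPred_eq, hi]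
    positivity
  obtain ⟨δ, hδ, hleb⟩ := lebesgue_number_lemma_of_metric isCompact_univ hU hcov
  have hsmall : vertices (n + 2) ∈
      supported (Small (Metric.diam (stdSimplex ℝ (Fin (n + 2))))) :=
    single_mem_supported (fun i j => Metric.dist_le_diam_of_mem (bounded_stdSimplex _)
      (single_mem_stdSimplex ℝ _) (single_mem_stdSimplex ℝ _)) 1
  obtain ⟨K, hK⟩ := exists_sd_iterate_small (half_pos hδ) Metric.diam_nonneg _ hsmall
  refine ⟨K, fun k hk => ?_⟩
  have hmem : (sd _ (n + 2))^[k] (vertices (n + 2)) ∈ supported fun v =>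
      In (stdSimplex ℝ (Fin (n + 2))) v ∧ Small (δ / 2) v := by
    have h1 := sd_iterate_vertices_mem k (n + 2)
    have h2 := hK k hk
    rw [supported, Finsupp.mem_supported] at h1 h2 ⊢
    exact fun v hv => ⟨h1 hv, h2 hv⟩
  refine eq_zero_of_supported
    (detCochain (n + 2) ∘ₗ map ((labelVertex ∘ p) ∘ extendSimplex σ) (n + 2))
    (fun v hv => ?_) hmem
  obtain ⟨i, hi⟩ := hleb ⟨v 0, hv.1 0⟩ (Set.mem_univ _)
  rw [LinearMap.comp_apply, map_single]
  refine detCochain_eq_zero_of_face i (single_mem_supported (fun j => ?_) 1)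
  have hj : (⟨v j, hv.1 j⟩ : stdSimplex ℝ (Fin (n + 2))) ∈ U i := hi (by
    rw [Metric.mem_ball, Subtype.dist_eq]
    exact (hv.2 j 0).trans_lt (half_lt_self hδ))
  simp only [Function.comp_apply, Set.mem_ofPred_eq]
  rw [extendSimplex_of_mem _ (hv.1 j)]
  exact labelVertex_apply_of_lt (hΔ _) hj

/-- The standard `n`-simplex as a topological space. -/
abbrev simplexSpace (n : ℕ) : TopCat.{u} := TopCat.of (ULift.{u} (stdSimplex ℝ (Fin (n + 1))))

/-- The boundary of the standard `n`-simplex. -/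
def simplexBoundary (n : ℕ) : Set (simplexSpace.{u} n) := {x | ∃ i, x.down.1 i = 0}

/-- The identity of the standard simplex as a singular simplex. -/
def idSimplex (n : ℕ) : C(stdSimplex ℝ (Fin (n + 1)), simplexSpace.{u} n) :=
  ⟨ULift.up, continuous_uliftUp⟩

/-- The boundary of the identity simplex does not bound in the boundary of the simplex. -/
lemma d_subspaceMap_ne (n : ℕ)
    (y : (singularChains (TopCat.of (simplexBoundary.{u} (n + 1)))).X (n + 1)) :
    (singularChains _).d (n + 1) n ((chainMap (subspaceMap (simplexBoundary (n + 1)))).f (n + 1) y)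
      ≠ (singularChains _).d (n + 1) n (simplexChain 1 (idSimplex.{u} (n + 1))) := by
  intro h
  let p : simplexSpace.{u} (n + 1) → Fin (n + 2) → ℝ := fun x => x.down.1
  have hp : Continuous p := continuous_subtype_val.comp continuous_uliftDown
  let G : simplexSpace.{u} (n + 1) → Fin (n + 2) → ℝ := labelVertex ∘ p
  let ψ : ℕ → (singularChains (simplexSpace.{u} (n + 1))).X (n + 1) →+ ℝ := fun k =>
    (detCochain (n + 2)).toAddMonoidHom.comp (sample G k (n + 1))
  have hψ : ∀ k x, ψ k x = detCochain (n + 2) (sample G k (n + 1) x) := fun k x => rfl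
  have hG : ∀ x, G x ∈ ({x | ∑ i, x i = 1} : Set (Fin (n + 2) → ℝ)) :=
    fun x => (labelVertex_mem (p x)).2
  -- A cycle has total labelled volume `0`.
  have h1 : ∀ k, ψ k ((chainMap (subspaceMap (simplexBoundary (n + 1)))).f (n + 1) y -
      simplexChain 1 (idSimplex.{u} (n + 1))) = 0 := fun k => by
    rw [hψ]
    refine detCochain_eq_zero_of_cycle (N := n + 1) (sample_mem hG k _) ?_
    rw [boundary_sample, map_sub, h, sub_self, map_zero]
  have h2 : ∀ k, ψ k (simplexChain 1 (idSimplex.{u} (n + 1))) = 1 := fun k => by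
    rw [hψ, sample_simplexChain, one_smul]
    refine Eq.trans (congrArg (detCochain (n + 2)) ?_) (detCochain_map_labelVertex (N := n + 2) k)
    refine map_congr_of_supported (fun v hv j => ?_) (sd_iterate_vertices_mem k (n + 2))
    simp only [Function.comp_apply]
    rw [extendSimplex_of_mem _ (hv j)]
    rfl
  have h3 : ∃ k, ψ k ((chainMap (subspaceMap (simplexBoundary (n + 1)))).f (n + 1) y) = 0 := by
    obtain ⟨l, a, τ, rfl⟩ := exists_eq_sum_simplexChain y
    choose K hK using fun j => exists_detCochain_sampleSimplex_eq_zero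
      (X := TopCat.of (simplexBoundary.{u} (n + 1))) (p := fun x => p x.1)
      (hp.comp continuous_subtype_val) (fun x => x.1.down.2) (fun x => x.2) (τ j)
    refine ⟨Finset.univ.sup K, ?_⟩
    rw [map_sum, map_sum]
    refine Finset.sum_eq_zero fun j _ => ?_
    rw [chainMap_simplexChain, hψ, sample_simplexChain, map_smul]
    have := hK j _ (Finset.le_sup (Finset.mem_univ j))
    have h4 : sampleSimplex G (Finset.univ.sup K)
        ((subspaceMap (simplexBoundary.{u} (n + 1))).hom.comp (τ j)) =
        sampleSimplex (labelVertex ∘ fun x : TopCat.of (simplexBoundary.{u} (n + 1)) => p x.1)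
          (Finset.univ.sup K) (τ j) := by
      refine map_congr_of_supported (fun v hv i => ?_) (sd_iterate_vertices_mem _ (n + 2))
      simp only [Function.comp_apply]
      rw [extendSimplex_of_mem _ (hv i), extendSimplex_of_mem _ (hv i)]
      rfl
    rw [h4, this, smul_zero]
  obtain ⟨k, hk⟩ := h3
  have := h1 k
  rw [map_sub, h2, hk] at this
  norm_num at this

lemma zsmul_simplexChain {X : TopCat.{u}} {m : ℕ} (k : ℤ)
    (σ : C(stdSimplex ℝ (Fin (m + 1)), X)) : k • simplexChain 1 σ = simplexChain k σ := by
  have := map_zsmul (AddCommGrpCat.Hom.hom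
    (SSet.ιChainComplex (R := integers.{u}) (TopCat.toSSet.obj X)
      ((TopCat.toSSetObjEquiv X (op ⦋m⦌)).symm σ))) k (ULift.up 1)
  refine this.symm.trans ?_
  rw [simplexChain]
  congr 1
  ext
  simp

lemma range_simplexFace_idSimplex (n : ℕ) (i : Fin (n + 2)) :
    Set.range (simplexFace i (idSimplex.{u} (n + 1))) ⊆ simplexBoundary.{u} (n + 1) := by
  rintro _ ⟨t, rfl⟩
  refine ⟨i, ?_⟩
  change FunOnFinite.linearMap ℝ ℝ i.succAbove t i = 0
  rw [FunOnFinite.linearMap_apply_apply]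
  refine Finset.sum_eq_zero fun j hj => ?_
  exact absurd (Finset.mem_filter.1 hj).2 (Fin.succAbove_ne i j)

/-- The boundary of the identity simplex, viewed in the boundary of the `(n + 1)`-simplex, is a
cycle that represents a nonzero class. -/
theorem exists_ne_zero_simplexBoundary (n : ℕ) :
    ∃ c : (singularHomology n).obj (TopCat.of (simplexBoundary.{u} (n + 1))), c ≠ 0 := by
  obtain ⟨z, hz⟩ := exists_cycle_of_range_subset (simplexBoundary.{u} (n + 1))
    (x := (singularChains _).d (n + 1) n (simplexChain 1 (idSimplex.{u} (n + 1))))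
    (fun j => by
      rw [← ConcreteCategory.comp_apply, HomologicalComplex.d_comp_d]
      rfl)
    (fun i : Fin (n + 2) => (-1 : ℤ) ^ (i : ℕ))
    (fun i => simplexFace i (idSimplex.{u} (n + 1)))
    (by simp only [d_simplexChain, zsmul_simplexChain])
    (range_simplexFace_idSimplex n)
  refine ⟨(singularChains _).homologyπ n z, fun h0 => ?_⟩
  obtain ⟨y, hy⟩ := exists_d_eq_of_homologyπ_eq_zero z h0
  refine d_subspaceMap_ne n y ?_
  rw [← hz, ← hy, ← ConcreteCategory.comp_apply, HomologicalComplex.Hom.comm,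
    ConcreteCategory.comp_apply]

end Sperner

/-! ### The homology of the sphere and of its proper subspaces -/

section Sphere

variable {n : ℕ}

/-- Subtracting the smallest coordinate and rescaling to coordinate sum `1`. -/
def normalizeMin (z : Fin (n + 2) → ℝ) (i : Fin (n + 2)) : ℝ :=
  (z i - Finset.univ.inf' Finset.univ_nonempty z) /
    ∑ j, (z j - Finset.univ.inf' Finset.univ_nonempty z)

lemma inf'_eq_of_forall_le {z : Fin (n + 2) → ℝ} {i : Fin (n + 2)} (h : ∀ j, z i ≤ z j) :
    Finset.univ.inf' Finset.univ_nonempty z = z i :=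
  le_antisymm (Finset.inf'_le _ (Finset.mem_univ i)) (Finset.le_inf' _ _ fun j _ => h j)

lemma sum_sub_inf'_pos {z : Fin (n + 2) → ℝ} {i j : Fin (n + 2)} (h : z i ≠ z j) :
    0 < ∑ j, (z j - Finset.univ.inf' Finset.univ_nonempty z) := by
  have hle : ∀ k, Finset.univ.inf' Finset.univ_nonempty z ≤ z k := fun k =>
    Finset.inf'_le _ (Finset.mem_univ k)
  refine Finset.sum_pos' (fun k _ => sub_nonneg.2 (hle k)) ?_
  by_contra! hcon
  have : ∀ k, z k = Finset.univ.inf' Finset.univ_nonempty z := fun k =>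
    le_antisymm (sub_nonpos.1 (hcon k (Finset.mem_univ k))) (hle k)
  exact h ((this i).trans (this j).symm)

lemma normalizeMin_mem {z : Fin (n + 2) → ℝ} {i j : Fin (n + 2)} (h : z i ≠ z j) :
    normalizeMin z ∈ stdSimplex ℝ (Fin (n + 2)) := by
  have hpos := sum_sub_inf'_pos h
  refine ⟨fun k => div_nonneg (sub_nonneg.2 (Finset.inf'_le _ (Finset.mem_univ k))) hpos.le, ?_⟩
  simp only [normalizeMin]
  rw [← Finset.sum_div, div_self hpos.ne']

lemma exists_normalizeMin_eq_zero (z : Fin (n + 2) → ℝ) : ∃ i, normalizeMin z i = 0 := by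
  obtain ⟨i, hi⟩ := Finite.exists_min z
  exact ⟨i, by rw [normalizeMin, inf'_eq_of_forall_le hi, sub_self, zero_div]⟩

lemma normalizeMin_mul_sub {x : Fin (n + 2) → ℝ} (hx : x ∈ stdSimplex ℝ (Fin (n + 2)))
    {i : Fin (n + 2)} (hi : x i = 0) {r : ℝ} (hr : 0 < r) (a : ℝ) :
    normalizeMin (fun j => r * (x j - a)) = x := by
  have hinf : Finset.univ.inf' Finset.univ_nonempty (fun j => r * (x j - a)) = r * (x i - a) :=
    inf'_eq_of_forall_le (z := fun j => r * (x j - a)) fun j =>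
      mul_le_mul_of_nonneg_left (sub_le_sub_right (by rw [hi]; exact hx.1 j) a) hr.le
  have hsub : ∀ j, r * (x j - a) - r * (x i - a) = r * x j := fun j => by rw [hi]; ring
  funext j
  simp only [normalizeMin]
  rw [hinf]
  simp only [hsub]
  rw [← Finset.mul_sum, hx.2, mul_one, mul_div_cancel_left₀ _ hr.ne']

lemma exists_snoc_ne {y : EuclideanSpace ℝ (Fin (n + 1))} (hy : y ≠ 0) :
    ∃ i, (Fin.snoc (α := fun _ => ℝ) y.ofLp 0 : Fin (n + 2) → ℝ) i ≠
      (Fin.snoc (α := fun _ => ℝ) y.ofLp 0 : Fin (n + 2) → ℝ) (Fin.last _) := by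
  by_contra! h
  refine hy (PiLp.ext fun i => ?_)
  simpa using h i.castSucc

lemma continuous_normalizeMin_snoc : Continuous
    fun y : Metric.sphere (0 : EuclideanSpace ℝ (Fin (n + 1))) 1 =>
      normalizeMin (Fin.snoc (α := fun _ => ℝ) y.1.ofLp 0 : Fin (n + 2) → ℝ) := by
  have h1 : Continuous fun y : Metric.sphere (0 : EuclideanSpace ℝ (Fin (n + 1))) 1 =>
      (Fin.snoc (α := fun _ => ℝ) y.1.ofLp 0 : Fin (n + 2) → ℝ) := by
    refine continuous_pi fun i => ?_
    refine Fin.lastCases ?_ (fun j => ?_) i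
    · simpa using continuous_const
    · simp only [Fin.snoc_castSucc]
      fun_prop
  have h2 : ∀ i, Continuous fun y : Metric.sphere (0 : EuclideanSpace ℝ (Fin (n + 1))) 1 =>
      (Fin.snoc (α := fun _ => ℝ) y.1.ofLp 0 : Fin (n + 2) → ℝ) i -
        Finset.univ.inf' Finset.univ_nonempty
          (Fin.snoc (α := fun _ => ℝ) y.1.ofLp 0 : Fin (n + 2) → ℝ) := fun i =>
    ((continuous_apply i).comp h1).sub
      (Continuous.finset_inf'_apply _ fun j _ => (continuous_apply j).comp h1)
  refine continuous_pi fun i => (h2 i).div (continuous_finsetSum _ fun j _ => h2 j) fun y => ?_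
  obtain ⟨j, hj⟩ := exists_snoc_ne (Metric.ne_of_mem_sphere y.2 one_ne_zero)
  exact (sum_sub_inf'_pos hj).ne'

/-- The map from the sphere to the boundary of the simplex that is inverse to projecting the
simplex with vertices `e₀, …, eₙ, -(e₀ + ⋯ + eₙ)` radially to the sphere: a vector `y` is a
multiple of a boundary point whose barycentric coordinates are those of `(y, 0)`, up to an additive
and a positive multiplicative constant. -/
def sphereToBoundary (n : ℕ) : TopCat.sphere.{u} n ⟶ TopCat.of (simplexBoundary.{u} (n + 1)) :=
  TopCat.ofHom
    { toFun := fun y => ⟨ULift.up ⟨normalizeMin (Fin.snoc (α := fun _ => ℝ) y.down.1.ofLp 0),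
          normalizeMin_mem
            (exists_snoc_ne (Metric.ne_of_mem_sphere y.down.2 one_ne_zero)).choose_spec⟩,
        exists_normalizeMin_eq_zero _⟩
      continuous_toFun := ((continuous_uliftUp.comp
        ((continuous_normalizeMin_snoc.comp continuous_uliftDown).subtype_mk _)).subtype_mk _) }

/-- The linear map that sends the vertices of the standard simplex to `e₀, …, eₙ` and
`-(e₀ + ⋯ + eₙ)`. -/
def vertexDifference (x : Fin (n + 2) → ℝ) : EuclideanSpace ℝ (Fin (n + 1)) :=
  WithLp.toLp 2 fun i => x i.castSucc - x (Fin.last _)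

lemma vertexDifference_ne_zero {x : Fin (n + 2) → ℝ} (hx : x ∈ stdSimplex ℝ (Fin (n + 2)))
    (h0 : ∃ i, x i = 0) : vertexDifference x ≠ 0 := by
  intro h
  have hall : ∀ i, x i = x (Fin.last _) := fun i => by
    refine Fin.lastCases rfl (fun j => ?_) i
    have := congrArg (fun v : EuclideanSpace ℝ (Fin (n + 1)) => v j) h
    simp only [vertexDifference, PiLp.zero_apply] at this
    linarith
  obtain ⟨i, hi⟩ := h0
  have hz : ∀ j, x j = 0 := fun j => by rw [hall j, ← hall i, hi]
  have := hx.2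
  simp [hz] at this

/-- The radial projection of the boundary of the simplex to the sphere. -/
def boundaryToSphere (n : ℕ) : TopCat.of (simplexBoundary.{u} (n + 1)) ⟶ TopCat.sphere.{u} n :=
  TopCat.ofHom
    { toFun := fun x => ULift.up ⟨‖vertexDifference x.1.down.1‖⁻¹ • vertexDifference x.1.down.1, by
        rw [mem_sphere_zero_iff_norm, norm_smul, norm_inv, norm_norm,
          inv_mul_cancel₀ (norm_ne_zero_iff.2 (vertexDifference_ne_zero x.1.down.2 x.2))]⟩
      continuous_toFun := by
        have h : Continuous fun x : simplexBoundary.{u} (n + 1) =>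
            vertexDifference x.1.down.1 := by
          have hx : Continuous fun x : simplexBoundary.{u} (n + 1) => x.1.down.1 :=
            continuous_subtype_val.comp (continuous_uliftDown.comp continuous_subtype_val)
          refine (PiLp.continuous_toLp 2 _).comp (continuous_pi fun i => ?_)
          exact ((continuous_apply _).comp hx).sub ((continuous_apply _).comp hx)
        exact continuous_uliftUp.comp (((h.norm.inv₀ fun x => norm_ne_zero_iff.2
          (vertexDifference_ne_zero x.1.down.2 x.2)).smul h).subtype_mk _) }

lemma boundaryToSphere_sphereToBoundary (n : ℕ) :
    boundaryToSphere.{u} n ≫ sphereToBoundary n = 𝟙 _ := by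
  refine TopCat.hom_ext (ContinuousMap.ext fun x => ?_)
  refine Subtype.ext (ULift.ext _ _ (Subtype.ext ?_))
  obtain ⟨i, hi⟩ := x.2
  have hpos : 0 < ‖vertexDifference x.1.down.1‖⁻¹ :=
    inv_pos.2 (norm_pos_iff.2 (vertexDifference_ne_zero x.1.down.2 x.2))
  refine Eq.trans ?_ (normalizeMin_mul_sub x.1.down.2 hi hpos (x.1.down.1 (Fin.last _)))
  refine congrArg normalizeMin (funext fun j => ?_)
  refine Fin.lastCases ?_ (fun k => ?_) j
  · rw [Fin.snoc_last, sub_self, mul_zero]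
  · rw [Fin.snoc_castSucc]
    rfl

/-- The `n`-sphere retracts onto a copy of the boundary of the `(n + 1)`-simplex, so its `n`-th
homology does not vanish. -/
theorem exists_ne_zero_sphere (n : ℕ) :
    ∃ c : (singularHomology n).obj (TopCat.sphere.{u} n), c ≠ 0 := by
  obtain ⟨c, hc⟩ := exists_ne_zero_simplexBoundary.{u} n
  refine ⟨(singularHomology n).map (boundaryToSphere n) c, fun h => hc ?_⟩
  have h1 : (singularHomology n).map (sphereToBoundary n)
      ((singularHomology n).map (boundaryToSphere n) c) = c := by
    rw [← ConcreteCategory.comp_apply, ← Functor.map_comp, boundaryToSphere_sphereToBoundary,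
      CategoryTheory.Functor.map_id, ConcreteCategory.id_apply]
  rw [← h1, h, map_zero]

/-- The inclusion of a proper subspace of the sphere is homotopic to the constant map to the
antipode of a missing point. -/
lemma map_subspaceMap_sphere_eq_zero (hn : n ≠ 0) {M : Set (TopCat.sphere.{u} n)}
    (hM : M ≠ Set.univ) : (singularHomology n).map (subspaceMap M) = 0 := by
  obtain ⟨p, hp⟩ := (Set.ne_univ_iff_exists_notMem M).1 hM
  let q : TopCat.sphere.{u} n := ULift.up (-p.down)
  let V : unitInterval × M → EuclideanSpace ℝ (Fin (n + 1)) := fun x =>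
    (1 - (x.1 : ℝ)) • x.2.1.down.1 - (x.1 : ℝ) • p.down.1
  have hV : Continuous V := by
    have h0 : Continuous fun y : TopCat.sphere.{u} n => y.down.1 :=
      continuous_subtype_val.comp continuous_uliftDown
    have h1 : Continuous fun x : unitInterval × M => x.2.1.down.1 :=
      h0.comp (continuous_subtype_val.comp continuous_snd)
    have h2 : Continuous fun x : unitInterval × M => (x.1 : ℝ) :=
      continuous_subtype_val.comp continuous_fst
    exact ((continuous_const.sub h2).smul h1).sub (h2.smul continuous_const)
  have hV0 : ∀ x, V x ≠ 0 := by
    rintro ⟨t, x⟩ h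
    have h1 : (1 - (t : ℝ)) • x.1.down.1 = (t : ℝ) • p.down.1 := sub_eq_zero.1 h
    have h2 := congrArg norm h1
    rw [norm_smul, norm_smul, norm_eq_of_mem_sphere, norm_eq_of_mem_sphere, mul_one, mul_one,
      Real.norm_of_nonneg (sub_nonneg.2 t.2.2), Real.norm_of_nonneg t.2.1] at h2
    have h3 : (t : ℝ) = 1 / 2 := by linarith
    rw [h2] at h1
    have h4 : x.1.down.1 = p.down.1 := smul_right_injective _ (by rw [h3]; norm_num) h1
    have h5 : x.1 = p := ULift.ext _ _ (Subtype.ext h4)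
    exact hp (h5 ▸ x.2)
  let toPoint : TopCat.of M ⟶ TopCat.of PUnit.{u + 1} := TopCat.ofHom (ContinuousMap.const _ ⟨⟩)
  let fromPoint : TopCat.of PUnit.{u + 1} ⟶ TopCat.sphere.{u} n :=
    TopCat.ofHom (ContinuousMap.const _ q)
  have hVs : ∀ x, ‖V x‖⁻¹ • V x ∈ Metric.sphere (0 : EuclideanSpace ℝ (Fin (n + 1))) 1 :=
    fun x => by
      rw [mem_sphere_zero_iff_norm, norm_smul, norm_inv, norm_norm,
        inv_mul_cancel₀ (norm_ne_zero_iff.2 (hV0 x))]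
  have hVc : Continuous fun x => ‖V x‖⁻¹ • V x :=
    (hV.norm.inv₀ fun x => norm_ne_zero_iff.2 (hV0 x)).smul hV
  let H : TopCat.Homotopy (subspaceMap M) (toPoint ≫ fromPoint) :=
    { toFun := fun x => ULift.up ⟨‖V x‖⁻¹ • V x, hVs x⟩
      continuous_toFun := continuous_uliftUp.comp (hVc.subtype_mk hVs)
      map_zero_left := fun x => by
        refine ULift.ext _ _ (Subtype.ext ?_)
        have : V (0, x) = x.1.down.1 := by simp [V]
        simp only [this]
        rw [norm_eq_of_mem_sphere, inv_one, one_smul]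
        rfl
      map_one_left := fun x => by
        refine ULift.ext _ _ (Subtype.ext ?_)
        have : V (1, x) = -p.down.1 := by simp [V]
        simp only [this]
        rw [norm_neg, norm_eq_of_mem_sphere, inv_one, one_smul]
        rfl }
  have hH : (singularHomology n).map (subspaceMap M) =
      (singularHomology n).map (toPoint ≫ fromPoint) :=
    H.congr_homologyMap_singularChainComplexFunctor integers.{u} n
  rw [hH, Functor.map_comp]
  have : Limits.IsZero ((singularHomology n).obj (TopCat.of PUnit.{u + 1})) :=
    isZero_singularHomologyFunctor_of_totallyDisconnectedSpace _ n _ _ hn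
  rw [this.eq_zero_of_tgt ((singularHomology n).map toPoint), Limits.zero_comp]

end Sphere

/-! ### Transport along a hereditary equivalence -/

lemma isIso_subspaceMap {X : TopCat.{u}} {K : Set X} (hK : K = Set.univ) :
    IsIso (subspaceMap K) := by
  subst hK
  exact (TopCat.isoOfHomeo (X := TopCat.of (Set.univ : Set X)) (Y := X)
    (Homeomorph.Set.univ X)).isIso_hom

lemma inclusion_subspaceMap {X : TopCat.{u}} {N M : Set X} (h : N ⊆ M) :
    inclusion h ≫ subspaceMap M = subspaceMap N := rfl

namespace HereditaryEquiv

variable {F : TopCat.{u} ⥤ AddCommGrpCat.{w}} {X Y : TopCat.{u}}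

/-- Whether a subspace carries homology of the whole space is preserved by a hereditary
equivalence. -/
lemma map_subspaceMap_eq_zero (e : HereditaryEquiv F X Y) {M : Set X}
    (h : F.map (subspaceMap (e.toEquiv '' M)) = 0) : F.map (subspaceMap M) = 0 := by
  have hu : IsIso (subspaceMap (e.toEquiv '' Set.univ)) := isIso_subspaceMap (by simp)
  have h1 : F.map (inclusion (Set.image_mono (f := e.toEquiv) (Set.subset_univ M))) = 0 := by
    rw [← inclusion_subspaceMap (Set.image_mono (Set.subset_univ M)), F.map_comp] at h
    exact Limits.zero_of_comp_mono _ h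
  have h2 := e.comm (Set.subset_univ M)
  rw [h1, Limits.comp_zero] at h2
  rw [← inclusion_subspaceMap (Set.subset_univ M), F.map_comp,
    Limits.zero_of_comp_mono _ h2.symm, Limits.zero_comp]

lemma exists_ne_zero (e : HereditaryEquiv F X Y) (h : ∃ c : F.obj Y, c ≠ 0) :
    ∃ c : F.obj X, c ≠ 0 := by
  have hu : IsIso (subspaceMap (e.toEquiv '' Set.univ)) := isIso_subspaceMap (by simp)
  have hu' : IsIso (subspaceMap (Set.univ : Set X)) := isIso_subspaceMap rfl
  let i : F.obj X ≅ F.obj Y := (F.mapIso (asIso (subspaceMap Set.univ))).symm ≪≫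
    e.iso Set.univ ≪≫ F.mapIso (asIso (subspaceMap (e.toEquiv '' Set.univ)))
  obtain ⟨c, hc⟩ := h
  refine ⟨i.inv c, fun h0 => hc ?_⟩
  rw [← ConcreteCategory.id_apply (X := F.obj Y) c, ← i.inv_hom_id, ConcreteCategory.comp_apply,
    h0, map_zero]

end HereditaryEquiv

/-! ### Spaces whose proper subspaces carry no homology -/

section Essential

variable {X : TopCat.{u}} {n : ℕ}

lemma map_eq_zero_of_forall_mem {F : TopCat.{u} ⥤ AddCommGrpCat.{w}} {Y : TopCat.{u}} {M : Set X}
    (hM : F.map (subspaceMap M) = 0) (f : Y ⟶ X) (hf : ∀ y, f y ∈ M) : F.map f = 0 := by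
  let g : Y ⟶ TopCat.of M := TopCat.ofHom ⟨fun y => ⟨f y, hf y⟩, by fun_prop⟩
  have : f = g ≫ subspaceMap M := rfl
  rw [this, F.map_comp, hM, Limits.comp_zero]

/-- If proper subspaces carry no homology of `X`, then the simplices of a cycle representing a
nonzero class cover `X`. -/
lemma iUnion_range_eq_univ
    (hX : ∀ M : Set X, M ≠ Set.univ → (singularHomology n).map (subspaceMap M) = 0)
    {c : (singularHomology n).obj X} (hc : c ≠ 0) {k : ℕ} {a : Fin k → ℤ}
    {σ : Fin k → C(stdSimplex ℝ (Fin (n + 1)), X)} (h : IsRepresentedBy c a σ) :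
    ⋃ i, Set.range (σ i) = Set.univ := by
  by_contra hne
  obtain ⟨c', hc'⟩ := exists_map_eq_of_isRepresentedBy h (K := ⋃ i, Set.range (σ i))
    fun i => Set.subset_iUnion (fun i => Set.range (σ i)) i
  rw [hX _ hne] at hc'
  exact hc hc'.symm

/-- A separation `X = A ∪ Aᶜ` lets a cycle be split into a part in `A` and a part in `Aᶜ`. On the
level of maps: if `p` collapses `Aᶜ` to `a ∈ A`, `q` collapses `A` to `b ∉ A` and `s` maps `A` to
`b` and `Aᶜ` to `a`, then `p + q = 1 + s` on singular chains, while each of `p`, `q`, `s` factors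
through a subspace that carries no homology of `X`. -/
lemma preconnectedSpace_of_map_subspaceMap_eq_zero [T1Space X] (hn : n ≠ 0)
    (hX : ∀ M : Set X, M ≠ Set.univ → (singularHomology n).map (subspaceMap M) = 0)
    {c : (singularHomology n).obj X} (hc : c ≠ 0) : PreconnectedSpace X := by
  classical
  rw [preconnectedSpace_iff_clopen]
  intro A hA
  by_contra! hcon
  obtain ⟨⟨a, ha⟩, hAu⟩ := hcon
  obtain ⟨b, hb⟩ := (Set.ne_univ_iff_exists_notMem A).1 hAu
  have hcont : ∀ f g : X → X, Continuous f → Continuous g → Continuous (A.piecewise f g) :=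
    fun f g hf hg => hf.piecewise (by simp [hA.frontier_eq]) hg
  let p : X ⟶ X := TopCat.ofHom ⟨_, hcont id (fun _ => a) continuous_id continuous_const⟩
  let q : X ⟶ X := TopCat.ofHom ⟨_, hcont (fun _ => b) id continuous_const continuous_id⟩
  let s : X ⟶ X := TopCat.ofHom ⟨_, hcont (fun _ => b) (fun _ => a) continuous_const
    continuous_const⟩
  have hsum : chainMap p + chainMap q = 𝟙 _ + chainMap s := by
    refine HomologicalComplex.hom_ext _ _ fun m => chain_hom_ext fun r σ => ?_
    change (chainMap p).f m _ + (chainMap q).f m _ = simplexChain r σ + (chainMap s).f m _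
    simp only [chainMap_simplexChain]
    have hσA : Set.range σ ⊆ A ∨ Set.range σ ⊆ Aᶜ := by
      by_cases hne : (Set.range σ ∩ A).Nonempty
      · exact Or.inl ((isPreconnected_range σ.continuous).subset_isClopen hA hne)
      · exact Or.inr fun y hy hyA => hne ⟨y, hy, hyA⟩
    rcases hσA with h | h
    · have h1 : p.hom.comp σ = σ := ContinuousMap.ext fun t =>
        Set.piecewise_eq_of_mem A id (fun _ => a) (h ⟨t, rfl⟩)
      have h2 : q.hom.comp σ = s.hom.comp σ := ContinuousMap.ext fun t =>
        (Set.piecewise_eq_of_mem A (fun _ => b) id (h ⟨t, rfl⟩)).trans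
          (Set.piecewise_eq_of_mem A (fun _ => b) (fun _ => a) (h ⟨t, rfl⟩)).symm
      rw [h1, h2]
    · have h1 : q.hom.comp σ = σ := ContinuousMap.ext fun t =>
        Set.piecewise_eq_of_notMem A (fun _ => b) id (h ⟨t, rfl⟩)
      have h2 : p.hom.comp σ = s.hom.comp σ := ContinuousMap.ext fun t =>
        (Set.piecewise_eq_of_notMem A id (fun _ => a) (h ⟨t, rfl⟩)).trans
          (Set.piecewise_eq_of_notMem A (fun _ => b) (fun _ => a) (h ⟨t, rfl⟩)).symm
      rw [h1, h2, add_comm]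
  have hp : HomologicalComplex.homologyMap (chainMap p) n = 0 := by
    refine map_eq_zero_of_forall_mem (F := singularHomology n) (hX A hAu) p fun y => ?_
    change A.piecewise id (fun _ => a) y ∈ A
    by_cases hy : y ∈ A <;> simp [hy, ha]
  have hq : HomologicalComplex.homologyMap (chainMap q) n = 0 := by
    refine map_eq_zero_of_forall_mem (F := singularHomology n) (hX Aᶜ fun h => ?_) q fun y => ?_
    · exact (h ▸ Set.mem_univ a : a ∈ Aᶜ) ha
    · change A.piecewise (fun _ => b) id y ∈ Aᶜ
      by_cases hy : y ∈ A <;> simp [hy, hb]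
  have hs : HomologicalComplex.homologyMap (chainMap s) n = 0 := by
    have hfin : Finite ({a, b} : Set X) := Set.toFinite _
    have hz : Limits.IsZero ((singularHomology n).obj (TopCat.of ({a, b} : Set X))) := by
      have : TotallyDisconnectedSpace (TopCat.of ({a, b} : Set X)) :=
        inferInstanceAs (TotallyDisconnectedSpace ({a, b} : Set X))
      exact isZero_singularHomologyFunctor_of_totallyDisconnectedSpace _ n _ _ hn
    refine map_eq_zero_of_forall_mem (F := singularHomology n) (M := {a, b})
      (hz.eq_zero_of_src _) s fun y => ?_
    change A.piecewise (fun _ => b) (fun _ => a) y ∈ ({a, b} : Set X)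
    by_cases hy : y ∈ A <;> simp [hy]
  have hid := congrArg (fun f => HomologicalComplex.homologyMap f n) hsum
  simp only [HomologicalComplex.homologyMap_add, HomologicalComplex.homologyMap_id] at hid
  rw [hp, hq, hs, add_zero, add_zero] at hid
  exact hc (ConcreteCategory.congr_hom hid c).symm

/-- A Hausdorff space covered by finitely many singular simplices is a quotient of their disjoint
union. -/
lemma locallyConnectedSpace_of_iUnion_range_eq_univ {X : Type*} [TopologicalSpace X] [T2Space X]
    {k : ℕ} (σ : Fin k → C(stdSimplex ℝ (Fin (n + 1)), X))
    (h : ⋃ i, Set.range (σ i) = Set.univ) : LocallyConnectedSpace X := by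
  have := (convex_stdSimplex ℝ (Fin (n + 1))).locallyPathConnectedSpace
  let f : (Σ _ : Fin k, stdSimplex ℝ (Fin (n + 1))) → X := fun t => σ t.1 t.2
  have hf : Continuous f := continuous_sigma fun i => (σ i).continuous
  have hsurj : Function.Surjective f := fun x => by
    obtain ⟨i, t, ht⟩ := Set.mem_iUnion.1 (h ▸ Set.mem_univ x : x ∈ ⋃ i, Set.range (σ i))
    exact ⟨⟨i, t⟩, ht⟩
  have := (hf.isClosedMap.isQuotientMap hf hsurj).locallyPathConnectedSpace
  infer_instance

lemma compactSpace_of_iUnion_range_eq_univ {X : Type*} [TopologicalSpace X]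
    {k : ℕ} (σ : Fin k → C(stdSimplex ℝ (Fin (n + 1)), X))
    (h : ⋃ i, Set.range (σ i) = Set.univ) : CompactSpace X :=
  ⟨h ▸ isCompact_iUnion fun i => isCompact_range (σ i).continuous⟩

end Essential

end

end Bubble

theorem mainTheorem2 (n : ℕ) (hn : 1 ≤ n) (X : Type u) [TopologicalSpace X]
    [TopologicalSpace.MetrizableSpace X]
    (hX : Bubble.IsBubble (Bubble.singularHomology.{u} n) n (TopCat.of X)) :
    Bubble.IsPeanoContinuum X ∧
      ∀ (c : (Bubble.singularHomology.{u} n).obj (TopCat.of X)),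
        AddSubgroup.zmultiples c = ⊤ →
        ∀ (m : ℕ) (a : Fin m → ℤ) (σ : Fin m → C(stdSimplex ℝ (Fin (n + 1)), TopCat.of X)),
          Bubble.IsRepresentedBy c a σ → ⋃ i, Set.range (σ i) = Set.univ := by
  obtain ⟨e⟩ := hX
  have hn0 : n ≠ 0 := Nat.one_le_iff_ne_zero.1 hn
  have hproper : ∀ M : Set (TopCat.of X), M ≠ Set.univ →
      (Bubble.singularHomology n).map (Bubble.subspaceMap M) = 0 := fun M hM =>
    e.map_subspaceMap_eq_zero (Bubble.map_subspaceMap_sphere_eq_zero hn0 fun h => hM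
      (e.toEquiv.injective.image_injective (h.trans (by simp))))
  obtain ⟨c₀, hc₀⟩ := e.exists_ne_zero (Bubble.exists_ne_zero_sphere n)
  obtain ⟨k, a₀, σ₀, h₀⟩ := Bubble.exists_isRepresentedBy c₀
  have hcover := Bubble.iUnion_range_eq_univ hproper hc₀ h₀
  refine ⟨⟨inferInstance, Bubble.compactSpace_of_iUnion_range_eq_univ σ₀ hcover, ?_,
    Bubble.locallyConnectedSpace_of_iUnion_range_eq_univ (X := X) σ₀ hcover⟩,
    fun c hc m a σ h => Bubble.iUnion_range_eq_univ hproper (fun h0 => hc₀ ?_) h⟩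
  · have hT1 : T1Space (TopCat.of X) := inferInstanceAs (T1Space X)
    have hpre : PreconnectedSpace X :=
      Bubble.preconnectedSpace_of_map_subspaceMap_eq_zero (X := TopCat.of X) hn0 hproper hc₀
    have hne : Nonempty (TopCat.sphere.{u} n) :=
      ⟨ULift.up ⟨EuclideanSpace.single 0 1, by simp⟩⟩
    exact { toNonempty := hne.map e.toEquiv.symm }
  · have : c₀ ∈ AddSubgroup.zmultiples c := hc ▸ AddSubgroup.mem_top c₀
    rw [h0, AddSubgroup.zmultiples_zero_eq_bot] at this
    exact AddSubgroup.mem_bot.1 this
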